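/- A string rewriting system $R$ over a finite alphabet $\Sigma$ is a finite set of rules $l\to r$ with $l,r\in\Sigma^*$; it induces the rewrite relation $xly\to_R xry$ ($x,y\in\Sigma^*$, $l\to r$ in $R$). $R$ is convergent if it is terminating and confluent, and right-reduced if every right-hand side is irreducible. A redex is a string that ends in a left-hand side; it is innermost if no proper prefix of it is a redex; $R$ is forward-closed if every innermost redex can be reduced to its normal form in one step. $R$ is subterm-collapsing if there are a string $x$ and a non-empty string $y$ with $xy\to_R^* x$. Let $\mathrm{RHS}(R)$ be the set of all unordered pairs $\{xl_1,l_2\}$ such that $l_1\to r_1$ and $l_2\to r_2$ are distinct rules of $R$ and $r_2=xr_1$. It is quasi-deterministic if in none of its pairs a side is empty, in none of its pairs the two sides have the same rightmost symbol, and no two distinct pairs have the same unordered pair of rightmost symbols. $R$ is an LM-system if it is convergent, right-reduced, not subterm-collapsing and forward-closed, and $\mathrm{RHS}(R)$ is quasi-deterministic. Then the following two problems are decidable, each by one algorithm that takes the alphabet and the rules as its input. (1) Given a convergent, forward-closed, right-reduced string rewriting system $R$: is $R$ subterm-collapsing? (2) Given a convergent, forward-closed string rewriting system $R$: is $R$ an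 LM-system? -/

import Mathlib

/-- A string rewriting system over the alphabet `α`: a set of rules `(l, r)`, read `l → r`. -/
abbrev SRS (α : Type*) := Set (List α × List α)

namespace SRS

variable {α : Type*}

/-- One rewrite step: `x l y → x r y` for a rule `(l, r)`. -/
def Step (R : SRS α) (s t : List α) : Prop :=
  ∃ x y l r : List α, (l, r) ∈ R ∧ s = x ++ l ++ y ∧ t = x ++ r ++ y

/-- The reflexive transitive closure of the rewrite relation. -/
def Steps (R : SRS α) : List α → List α → Prop :=
  Relation.ReflTransGen R.Step

/-- There is no infinite chain of rewrite steps. -/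
def Terminating (R : SRS α) : Prop :=
  ¬ ∃ s : ℕ → List α, ∀ i, R.Step (s i) (s (i + 1))

/-- Any two descendants of a string have a common descendant. -/
def Confluent (R : SRS α) : Prop :=
  ∀ t s₁ s₂ : List α, R.Steps t s₁ → R.Steps t s₂ → ∃ t', R.Steps s₁ t' ∧ R.Steps s₂ t'

/-- Terminating and confluent. -/
def Convergent (R : SRS α) : Prop :=
  R.Terminating ∧ R.Confluent

/-- No rule of `R` can be applied to `w`. -/
def Irreducible (R : SRS α) (w : List α) : Prop :=
  ∀ w' : List α, ¬ R.Step w w'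

/-- `w'` is a normal form of `w`. -/
def IsNormalFormOf (R : SRS α) (w' w : List α) : Prop :=
  R.Steps w w' ∧ R.Irreducible w'

/-- Every right-hand side is in normal form. -/
def RightReduced (R : SRS α) : Prop :=
  ∀ l r : List α, (l, r) ∈ R → R.Irreducible r

/-- A redex is a string that ends in a left-hand side. -/
def IsRedex (R : SRS α) (w : List α) : Prop :=
  ∃ x l r : List α, (l, r) ∈ R ∧ w = x ++ l

/-- A redex is innermost if no proper prefix of it is a redex. -/
def IsInnermostRedex (R : SRS α) (w : List α) : Prop :=
  R.IsRedex w ∧ ∀ p : List α, p <+: w → p ≠ w → ¬ R.IsRedex p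

/-- Every innermost redex can be reduced to its normal form in one step. -/
def ForwardClosed (R : SRS α) : Prop :=
  ∀ w : List α, R.IsInnermostRedex w → ∃ w', R.Step w w' ∧ R.IsNormalFormOf w' w

/-- The string `x` causes a subterm-collapse: `x y →* x` for some non-empty `y`. -/
def CausesSubtermCollapse (R : SRS α) (x : List α) : Prop :=
  ∃ y : List α, y ≠ [] ∧ R.Steps (x ++ y) x

/-- Some string causes a subterm-collapse. It makes no difference whether `x` may be empty:
if `y →* λ` then also `x y →* x` for every `x`. -/
def SubtermCollapsing (R : SRS α) : Prop :=
  ∃ x : List α, R.CausesSubtermCollapse x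

/-- The set of right-hand-side critical pairs: the unordered pairs `{x l₁, l₂}`, for distinct rules
`l₁ → r₁` and `l₂ → r₂` with `r₂ = x r₁`. -/
def RHS (R : SRS α) : Set (Sym2 (List α)) :=
  {e | ∃ l₁ r₁ l₂ r₂ x : List α, (l₁, r₁) ∈ R ∧ (l₂, r₂) ∈ R ∧ (l₁, r₁) ≠ (l₂, r₂) ∧
    r₂ = x ++ r₁ ∧ e = s(x ++ l₁, l₂)}

/-- The unordered pair of the rightmost symbols of the two sides of `e`
(`none` stands for an empty side). -/
def endPair (e : Sym2 (List α)) : Sym2 (Option α) :=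
  e.map List.getLast?

/-- Quasi-determinism of a set of unordered pairs of strings: no side is the empty string, no pair is
end-stable (the same rightmost symbol on both sides), and there are no end pair repetitions (no two
members have the same unordered pair of rightmost symbols). -/
def QuasiDeterministic (E : Set (Sym2 (List α))) : Prop :=
  (∀ e ∈ E, [] ∉ e) ∧ (∀ e ∈ E, ¬ (endPair e).IsDiag) ∧
    ∀ e ∈ E, ∀ e' ∈ E, e ≠ e' → endPair e ≠ endPair e'

/-- Lynch-Morawska string rewriting systems. -/
structure IsLMSystem (R : SRS α) : Prop where
  convergent : R.Convergent
  rightReduced : R.RightReduced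
  nonSubtermCollapsing : ¬ R.SubtermCollapsing
  forwardClosed : R.ForwardClosed
  quasiDeterministic : QuasiDeterministic R.RHS

/-- The system whose rules are the entries of a finite list. -/
def ofList (L : List (List α × List α)) : SRS α :=
  {p | p ∈ L}

/-- The input of an algorithm: the size of the alphabet `{0, …, k - 1}` and the list of rules,
with the letters written as natural numbers. -/
def code (k : ℕ) (L : List (List (Fin k) × List (Fin k))) : ℕ × List (List ℕ × List ℕ) :=
  (k, L.map fun p => (p.1.map Fin.val, p.2.map Fin.val))

/-- The decision problem `Given: a finite system with property P. Question: does it have property Q?`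
is effectively solvable: one algorithm, which takes the finite alphabet and the finite set of rules
as its input, answers correctly for every system with property `P`. -/
def EffectivelySolvable (P Q : ∀ k : ℕ, SRS (Fin k) → Prop) : Prop :=
  ∃ f : ℕ × List (List ℕ × List ℕ) → Bool, Computable f ∧
    ∀ (k : ℕ) (L : List (List (Fin k) × List (Fin k))),
      P k (ofList L) → (f (code k L) = true ↔ Q k (ofList L))

end SRS

/-! In a convergent forward-closed system the normal form can be kept as a stack while letters are
read. If `x` is irreducible, then `xa` is irreducible or an innermost redex, so either `a` is pushed
or a single rule `l → r` replaces the suffix `l` of `xa`. Seen from `x`, this is suffix rewriting by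
`([], [a])` or `(l.dropLast, r)`. A subterm-collapse is therefore the same as a cycle of suffix
rewriting by `appendRules` (`subtermCollapsing_iff`).

A cycle can be restarted at the step that leaves the longest possible prefix untouched to its left
throughout, so it exists iff some right-hand side rewrites to its own left-hand side
(`exists_transGen_suffixStep_self_iff`). Cutting a derivation at its lowest step leaves derivations
between suffixes of its ends and sides of rules. Hence only pairs of a suffix of a right-hand side
and a suffix of a left-hand side matter; they are finitely many, and saturation finds the derivable
ones (`derivablePairs`).

For LM-systems, right-reducedness and quasi-determinism remain, and both are finite comparisons of
rules. -/

namespace SRS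

/-! ### Suffix rewriting and its cycles -/

section SuffixRewriting

variable {α : Type*} {P : SRS α} {s t u x y p q : List α}

/-- One step of suffix rewriting: `x p ⇒ x q` for a rule `(p, q)`. -/
def SuffixStep (P : SRS α) (s t : List α) : Prop :=
  ∃ x p q : List α, (p, q) ∈ P ∧ s = x ++ p ∧ t = x ++ q

/-- The reflexive transitive closure of suffix rewriting, presented so that a derivation between
two strings is built from derivations between suffixes of them and sides of rules. -/
inductive Derives (P : SRS α) : List α → List α → Prop
  | refl (s : List α) : Derives P s s
  | step (x : List α) {s p q t : List α} (h : (p, q) ∈ P) (h₁ : Derives P s p)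
      (h₂ : Derives P q t) : Derives P (x ++ s) (x ++ t)

theorem SuffixStep.prepend (h : SuffixStep P s t) (x : List α) :
    SuffixStep P (x ++ s) (x ++ t) := by
  obtain ⟨y, p, q, hpq, rfl, rfl⟩ := h
  exact ⟨x ++ y, p, q, hpq, by simp, by simp⟩

theorem reflTransGen_suffixStep_prepend (h : Relation.ReflTransGen (SuffixStep P) s t)
    (x : List α) : Relation.ReflTransGen (SuffixStep P) (x ++ s) (x ++ t) :=
  h.lift (x ++ ·) fun _ _ h => h.prepend x

/-- Compare the new step with the lowest step of the given derivation: it either takes place above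
the prefix `y` and joins the left subderivation, or it reaches at least as deep and becomes the new
cut. -/
theorem Derives.head (h : SuffixStep P s t) (h' : Derives P t u) : Derives P s u := by
  induction h' generalizing s with
  | refl t =>
    obtain ⟨x, p, q, hpq, rfl, rfl⟩ := h
    exact .step x hpq (.refl p) (.refl q)
  | @step y s₁ p₁ q₁ t₁ h₁ hs ht ih _ =>
    obtain ⟨x, p, q, hpq, rfl, e⟩ := h
    rcases List.append_eq_append_iff.1 e with ⟨w, rfl, rfl⟩ | ⟨w, rfl, rfl⟩
    · rw [List.append_assoc]
      exact .step y h₁ (ih ⟨w, p, q, hpq, rfl, rfl⟩) ht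
    · rw [List.append_assoc]
      exact .step x hpq (.refl p) (.step w h₁ hs ht)

theorem derives_iff_reflTransGen :
    Derives P s t ↔ Relation.ReflTransGen (SuffixStep P) s t := by
  constructor
  · intro h
    induction h with
    | refl s => exact .refl
    | @step x s p q t h _ _ ih₁ ih₂ =>
      exact ((reflTransGen_suffixStep_prepend ih₁ x).tail ⟨x, p, q, h, rfl, rfl⟩).trans
        (reflTransGen_suffixStep_prepend ih₂ x)
  · intro h
    induction h using Relation.ReflTransGen.head_induction_on with
    | refl => exact .refl _
    | head h _ ih => exact ih.head h

theorem Derives.trans (h : Derives P s t) (h' : Derives P t u) : Derives P s u :=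
  derives_iff_reflTransGen.2
    ((derives_iff_reflTransGen.1 h).trans (derives_iff_reflTransGen.1 h'))

/-- Suffix rewriting has a cycle if and only if the right-hand side of some rule rewrites to the
left-hand side of the same rule. -/
theorem exists_transGen_suffixStep_self_iff :
    (∃ s, Relation.TransGen (SuffixStep P) s s) ↔ ∃ r ∈ P, Derives P r.2 r.1 := by
  constructor
  · rintro ⟨s, h⟩
    obtain ⟨t, ⟨x, p, q, hpq, rfl, rfl⟩, h⟩ := Relation.TransGen.head'_iff.1 h
    rw [← derives_iff_reflTransGen] at h
    generalize e₁ : x ++ q = a at h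
    generalize e₂ : x ++ p = b at h
    cases h with
    | refl =>
      obtain rfl : q = p := by simpa using e₁.trans e₂.symm
      exact ⟨_, hpq, .refl _⟩
    | @step y s₁ p₁ q₁ t₁ h₁ hs ht =>
      -- If the rest of the cycle leaves `x` untouched, it derives `p` from `q`. Otherwise its
      -- lowest rule `(p₁, q₁)` serves: going round from `q₁` through `w ++ p` and `w ++ q` leads to
      -- `p₁`.
      rcases List.append_eq_append_iff.1 e₁ with ⟨w, rfl, rfl⟩ | ⟨w, rfl, rfl⟩
      · obtain rfl : p = w ++ t₁ := by simpa using e₂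
        exact ⟨_, hpq, .step w h₁ hs ht⟩
      · obtain rfl : w ++ p = t₁ := by simpa using e₂
        exact ⟨_, h₁, ht.trans (.head ⟨w, p, q, hpq, rfl, rfl⟩ hs)⟩
  · rintro ⟨⟨p, q⟩, hpq, h⟩
    exact ⟨p, Relation.TransGen.head' ⟨[], p, q, hpq, rfl, rfl⟩ (derives_iff_reflTransGen.1 h)⟩

end SuffixRewriting

/-! ### Subterm-collapse as a cycle of suffix rewriting -/

section Collapse

variable {α : Type*} {R : SRS α} {s t u x y z : List α}

theorem Step.context (h : R.Step s t) (x y : List α) : R.Step (x ++ s ++ y) (x ++ t ++ y) := by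
  obtain ⟨u, v, l, r, hR, rfl, rfl⟩ := h
  exact ⟨x ++ u, v ++ y, l, r, hR, by simp, by simp⟩

theorem Steps.refl (R : SRS α) (s : List α) : R.Steps s s :=
  Relation.ReflTransGen.refl

theorem Steps.trans (h : R.Steps s t) (h' : R.Steps t u) : R.Steps s u :=
  Relation.ReflTransGen.trans h h'

theorem Steps.append_right (h : R.Steps s t) (y : List α) : R.Steps (s ++ y) (t ++ y) :=
  Relation.ReflTransGen.lift (· ++ y)
    (fun _ _ (h : R.Step _ _) => by simpa using h.context [] y) _ _ h

theorem Irreducible.eq_of_steps (h : R.Irreducible s) (h' : R.Steps s t) : t = s := by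
  rcases Relation.ReflTransGen.cases_head h' with rfl | ⟨u, hu, -⟩
  · rfl
  · exact (h u hu).elim

theorem Terminating.exists_isNormalFormOf (h : R.Terminating) (s : List α) :
    ∃ t, R.IsNormalFormOf t s := by
  by_contra hs
  have key : ∀ a : {t // R.Steps s t}, ∃ b : {t // R.Steps s t}, R.Step a b := by
    rintro ⟨t, ht⟩
    by_contra hn
    exact hs ⟨t, ht, fun w hw => hn ⟨⟨w, ht.tail hw⟩, hw⟩⟩
  choose f hf using key
  refine h ⟨fun n => (f^[n] ⟨s, .refl R s⟩ : {t // R.Steps s t}), fun i => ?_⟩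
  simp only [Function.iterate_succ_apply']
  exact hf _

theorem Confluent.eq_of_isNormalFormOf (h : R.Confluent) (hs : R.IsNormalFormOf s u)
    (ht : R.IsNormalFormOf t u) : s = t := by
  obtain ⟨v, hsv, htv⟩ := h u s t hs.1 ht.1
  rw [← hs.2.eq_of_steps hsv, ht.2.eq_of_steps htv]

theorem Terminating.ne_nil (h : R.Terminating) {l r : List α} (hlr : (l, r) ∈ R) : l ≠ [] := by
  rintro rfl
  -- An empty left-hand side applies to every string, so `r` can be prepended forever.
  refine h ⟨fun n => (fun w => r ++ w)^[n] [], fun i => ⟨[], _, [], r, hlr, rfl, ?_⟩⟩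
  simp [Function.iterate_succ_apply']

/-- The suffix rewriting rules that describe how the normal form of a string changes
when a letter is appended: the letter is either pushed, or completes a left-hand side. -/
def appendRules (R : SRS α) : SRS α :=
  {pq | (∃ ρ ∈ R, pq = (ρ.1.dropLast, ρ.2)) ∨ ∃ a : α, pq = ([], [a])}

theorem SuffixStep.exists_steps_append (hR : ∀ ρ ∈ R, ρ.1 ≠ [])
    (h : SuffixStep R.appendRules s t) : ∃ a : α, R.Steps (s ++ [a]) t := by
  obtain ⟨x, p, q, ⟨⟨l, r⟩, hρ, e⟩ | ⟨a, e⟩, rfl, rfl⟩ := h <;>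
    obtain ⟨rfl, rfl⟩ := Prod.mk.inj e
  -- Appending the last letter of `l` completes the left-hand side.
  · refine ⟨l.getLast (hR _ hρ), .single ⟨x, [], l, q, hρ, ?_, by simp⟩⟩
    simp [List.dropLast_append_getLast]
  · exact ⟨a, by simpa using Steps.refl R _⟩

theorem exists_steps_append_of_transGen (hR : ∀ ρ ∈ R, ρ.1 ≠ [])
    (h : Relation.TransGen (SuffixStep R.appendRules) s t) :
    ∃ y : List α, y ≠ [] ∧ R.Steps (s ++ y) t := by
  induction h with
  | single h =>
    obtain ⟨a, ha⟩ := h.exists_steps_append hR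
    exact ⟨[a], by simp, ha⟩
  | tail _ h ih =>
    obtain ⟨y, hy, hs⟩ := ih
    obtain ⟨a, ha⟩ := h.exists_steps_append hR
    refine ⟨y ++ [a], by simp, ?_⟩
    rw [← List.append_assoc]
    exact (hs.append_right [a]).trans ha

theorem Irreducible.not_isRedex_append (h : R.Irreducible (x ++ y)) : ¬ R.IsRedex x := by
  rintro ⟨u, l, r, hlr, rfl⟩
  exact h (u ++ r ++ y) ⟨u, y, l, r, hlr, rfl, rfl⟩

/-- A rewrite step from `x a`, where `x` is irreducible, rewrites a suffix. -/
theorem Irreducible.exists_of_step_concat (h : R.Irreducible x) {a : α}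
    (hw : R.Step (x ++ [a]) t) : ∃ u l r, (l, r) ∈ R ∧ x ++ [a] = u ++ l ∧ t = u ++ r := by
  obtain ⟨u, v, l, r, hlr, e, rfl⟩ := hw
  rcases List.eq_nil_or_concat v with rfl | ⟨v, b, rfl⟩
  · exact ⟨u, l, r, hlr, by simpa using e, by simp⟩
  · rw [List.concat_eq_append, ← List.append_assoc] at e
    obtain ⟨rfl, -⟩ := List.append_inj' e rfl
    exact (h _ ⟨u, v, l, r, hlr, rfl, rfl⟩).elim

/-- A reducible `x ++ [a]` is an innermost redex, because its proper prefixes are prefixes of the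
irreducible `x`. The one step given by forward closure must use the last letter, so it is a suffix
step from `x`. -/
theorem ForwardClosed.exists_normalForm_concat (hf : R.ForwardClosed)
    (hR : ∀ ρ ∈ R, ρ.1 ≠ []) (h : R.Irreducible x) (a : α) :
    ∃ z, R.IsNormalFormOf z (x ++ [a]) ∧ SuffixStep R.appendRules x z := by
  by_cases ha : R.Irreducible (x ++ [a])
  · exact ⟨_, ⟨.refl R _, ha⟩, x, [], [a], .inr ⟨a, rfl⟩, by simp, rfl⟩
  obtain ⟨w, hw⟩ : ∃ w, R.Step (x ++ [a]) w := by simpa [Irreducible] using ha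
  obtain ⟨u, l, r, hlr, e, rfl⟩ := h.exists_of_step_concat hw
  obtain ⟨z, hz, hnf⟩ := hf (x ++ [a]) ⟨⟨u, l, r, hlr, e⟩, fun p hp hne => by
    rcases List.prefix_concat_iff.1 hp with rfl | ⟨v, rfl⟩
    · exact (hne rfl).elim
    · exact h.not_isRedex_append⟩
  obtain ⟨u', l', r', hlr', e', rfl⟩ := h.exists_of_step_concat hz
  refine ⟨_, hnf, u', l'.dropLast, r', .inl ⟨(l', r'), hlr', rfl⟩, ?_, rfl⟩
  rw [← List.dropLast_append_of_ne_nil (hR _ hlr'), ← e', List.dropLast_concat]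

theorem ForwardClosed.exists_normalForm_append (hf : R.ForwardClosed)
    (hR : ∀ ρ ∈ R, ρ.1 ≠ []) (h : R.Irreducible x) (y : List α) :
    ∃ z, R.IsNormalFormOf z (x ++ y) ∧ Relation.ReflTransGen (SuffixStep R.appendRules) x z ∧
      (y ≠ [] → Relation.TransGen (SuffixStep R.appendRules) x z) := by
  induction y generalizing x with
  | nil => exact ⟨x, ⟨by simpa using Steps.refl R x, h⟩, .refl, by simp⟩
  | cons a y ih =>
    obtain ⟨z, hz, hs⟩ := hf.exists_normalForm_concat hR h a
    obtain ⟨w, hw, hzw, -⟩ := ih hz.2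
    have hxw := Relation.TransGen.head' hs hzw
    refine ⟨w, ⟨?_, hw.2⟩, hxw.to_reflTransGen, fun _ => hxw⟩
    have := Steps.trans (hz.1.append_right y) hw.1
    simpa using this

/-- Replace `x` by its normal form `x'`: uniqueness of normal forms makes `x'` the normal form of
`x' ++ y`, and reading the non-empty `y` gives a cycle at `x'`. Conversely, each step of a cycle is
simulated by appending one letter. -/
theorem subtermCollapsing_iff (hc : R.Convergent) (hf : R.ForwardClosed) :
    R.SubtermCollapsing ↔ ∃ ρ ∈ R.appendRules, Derives R.appendRules ρ.2 ρ.1 := by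
  have hR : ∀ ρ ∈ R, ρ.1 ≠ [] := fun ρ hρ => hc.1.ne_nil hρ
  rw [← exists_transGen_suffixStep_self_iff]
  constructor
  · rintro ⟨x, y, hy, hxy⟩
    obtain ⟨x', hx'⟩ := hc.1.exists_isNormalFormOf x
    obtain ⟨z, hz, -, hxz⟩ := hf.exists_normalForm_append hR hx'.2 y
    have e : z = x' := hc.2.eq_of_isNormalFormOf
      ⟨(hx'.1.append_right y).trans hz.1, hz.2⟩ ⟨hxy.trans hx'.1, hx'.2⟩
    exact ⟨x', e ▸ hxz hy⟩
  · rintro ⟨s, hs⟩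
    exact ⟨s, exists_steps_append_of_transGen hR hs⟩

end Collapse

end SRS

/-! ### Saturation of a finite list -/

namespace List

variable {α : Type*}

/-- Turns the search for a common prefix into a bounded one. -/
theorem exists_take_eq_take_iff {s t : List α} {Q : List α → List α → Prop} :
    (∃ i < s.length + 1, s.take i = t.take i ∧ Q (s.drop i) (t.drop i)) ↔
      ∃ x s' t', s = x ++ s' ∧ t = x ++ t' ∧ Q s' t' := by
  constructor
  · rintro ⟨i, -, h, hQ⟩
    exact ⟨s.take i, s.drop i, t.drop i, by simp, by simp [h], hQ⟩
  · rintro ⟨x, s, t, rfl, rfl, hQ⟩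
    exact ⟨x.length, by simp, by simp, by simpa using hQ⟩

/-- One round of the saturation of a sublist of `U` under the condition `c`. -/
def saturateStep (U : List α) (c : List α → α → Prop) [∀ E a, Decidable (c E a)] (E : List α) :
    List α :=
  U.filter (c E ·)

/-- The least sublist of `U` that is closed under the monotone condition `c`. -/
def saturate (U : List α) (c : List α → α → Prop) [∀ E a, Decidable (c E a)] : List α :=
  (U.saturateStep c)^[U.length] []

variable {U : List α} {c : List α → α → Prop} [∀ E a, Decidable (c E a)]

theorem iterate_saturateStep_sublist_succ
    (hc : ∀ E F a, E ⊆ F → c E a → c F a) (n : ℕ) :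
    ((U.saturateStep c)^[n] []).Sublist ((U.saturateStep c)^[n + 1] []) := by
  induction n with
  | zero => simp
  | succ n ih =>
    rw [Function.iterate_succ_apply', Function.iterate_succ_apply' _ (n + 1)]
    exact monotone_filter_right _ fun a ha =>
      decide_eq_true (hc _ _ a ih.subset (of_decide_eq_true ha))

theorem saturateStep_saturate (hc : ∀ E F a, E ⊆ F → c E a → c F a) :
    U.saturateStep c (U.saturate c) = U.saturate c := by
  -- The rounds increase, so each one either changes nothing or adds a member. The second option
  -- cannot persist for more than `U.length` rounds, since every round is a sublist of `U`.
  have key : ∀ n, (U.saturateStep c)^[n + 1] [] = (U.saturateStep c)^[n] [] ∨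
      n < ((U.saturateStep c)^[n + 1] []).length := by
    intro n
    have hs := iterate_saturateStep_sublist_succ (U := U) hc
    induction n with
    | zero =>
      by_cases h : ((U.saturateStep c)^[0 + 1] []) = []
      · exact .inl h
      · exact .inr (length_pos_iff.2 h)
    | succ n ih =>
      rcases ih with ih | ih
      · left
        rw [Function.iterate_succ_apply', ih, ← Function.iterate_succ_apply' (U.saturateStep c), ih]
      · by_cases h : ((U.saturateStep c)^[n + 1] []).length =
            ((U.saturateStep c)^[n + 1 + 1] []).length
        · exact .inl ((hs (n + 1)).eq_of_length h).symm
        · have := (hs (n + 1)).length_le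
          exact .inr (by omega)
  rw [saturate, ← Function.iterate_succ_apply' (U.saturateStep c)]
  rcases key U.length with h | h
  · exact h
  · rw [Function.iterate_succ_apply'] at h
    exact absurd h (length_filter_le _ _).not_gt

theorem mem_saturate (hc : ∀ E F a, E ⊆ F → c E a → c F a) {a : α} (ha : a ∈ U)
    (h : c (U.saturate c) a) : a ∈ U.saturate c := by
  rw [← saturateStep_saturate hc]
  simpa [saturateStep] using ⟨ha, h⟩

/-- Soundness: what every inference preserves holds for all members. -/
theorem saturate_induction {Q : α → Prop} (h : ∀ E a, (∀ b ∈ E, Q b) → c E a → Q a) :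
    ∀ a ∈ U.saturate c, Q a := by
  unfold saturate
  generalize U.length = n
  induction n with
  | zero => simp
  | succ n ih =>
    intro a ha
    rw [Function.iterate_succ_apply'] at ha
    exact h _ a ih (by simpa using (mem_filter.1 ha).2)

end List

/-! ### Deciding derivability between sides of rules -/

namespace SRS

section Saturation

variable {α : Type*}

/-- The pair `e` is derivable in one inference from the pairs in `E`. -/
def InferStep (P E : List (List α × List α)) (e : List α × List α) : Prop :=
  e.1 = e.2 ∨ ∃ ρ ∈ P, ∃ i < e.1.length + 1, e.1.take i = e.2.take i ∧
    (e.1.drop i, ρ.1) ∈ E ∧ (ρ.2, e.2.drop i) ∈ E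

instance [DecidableEq α] (P E : List (List α × List α)) (e : List α × List α) : Decidable (InferStep P E e) :=
  inferInstanceAs (Decidable (_ ∨ _))

theorem inferStep_iff {P E : List (List α × List α)} {s t : List α} :
    InferStep P E (s, t) ↔ s = t ∨ ∃ ρ ∈ P, ∃ x s' t', s = x ++ s' ∧ t = x ++ t' ∧
      (s', ρ.1) ∈ E ∧ (ρ.2, t') ∈ E := by
  simp only [InferStep, ← List.exists_take_eq_take_iff
    (Q := fun s' t' => (s', _) ∈ E ∧ (_, t') ∈ E)]

theorem InferStep.mono {P E F : List (List α × List α)} {e : List α × List α} (h : E ⊆ F)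
    (he : InferStep P E e) : InferStep P F e := by
  rcases he with he | ⟨ρ, hρ, i, hi, e₁, h₁, h₂⟩
  · exact .inl he
  · exact .inr ⟨ρ, hρ, i, hi, e₁, h h₁, h h₂⟩

/-- The list of all suffixes of the members of a list. -/
def suffixes (A : List (List α)) : List (List α) :=
  A.flatMap fun w => (List.range (w.length + 1)).map fun i => w.drop i

theorem mem_suffixes {A : List (List α)} {s : List α} : s ∈ suffixes A ↔ ∃ w ∈ A, s <:+ w := by
  simp only [suffixes, List.mem_flatMap, List.mem_map, List.mem_range]
  refine exists_congr fun w => and_congr_right fun _ => ⟨?_, ?_⟩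
  · rintro ⟨i, -, rfl⟩
    exact List.drop_suffix i w
  · rintro ⟨x, rfl⟩
    exact ⟨x.length, by simp, by simp⟩

/-- All pairs of a suffix of a right-hand side and a suffix of a left-hand side. -/
def suffixPairs (P : List (List α × List α)) : List (List α × List α) :=
  (suffixes (P.map Prod.snd)).flatMap fun s => (suffixes (P.map Prod.fst)).map fun t => (s, t)

/-- The derivable pairs of a suffix of a right-hand side and a suffix of a left-hand side. -/
def derivablePairs [DecidableEq α] (P : List (List α × List α)) : List (List α × List α) :=
  (suffixPairs P).saturate (InferStep P)

theorem mem_suffixPairs {P : List (List α × List α)} {s t : List α} :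
    (s, t) ∈ suffixPairs P ↔ (∃ ρ ∈ P, s <:+ ρ.2) ∧ ∃ ρ ∈ P, t <:+ ρ.1 := by
  simp only [suffixPairs, List.mem_flatMap, List.mem_map, mem_suffixes, Prod.mk.injEq]
  aesop

theorem derives_of_mem_derivablePairs [DecidableEq α] {P : List (List α × List α)} :
    ∀ e ∈ derivablePairs P, Derives (ofList P) e.1 e.2 := by
  refine List.saturate_induction fun E e hE he => ?_
  obtain ⟨s, t⟩ := e
  rcases inferStep_iff.1 he with rfl | ⟨ρ, hρ, x, s, t, rfl, rfl, hs, ht⟩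
  · exact .refl s
  · exact .step x hρ (hE _ hs) (hE _ ht)

/-- Completeness: the subderivations of a derivation again run from a suffix of a right-hand side to
a suffix of a left-hand side, so the induction never leaves `suffixPairs`. -/
theorem Derives.mem_derivablePairs [DecidableEq α] {P : List (List α × List α)} {s t : List α}
    (h : Derives (ofList P) s t) (hs : ∃ ρ ∈ P, s <:+ ρ.2) (ht : ∃ ρ ∈ P, t <:+ ρ.1) :
    (s, t) ∈ derivablePairs P := by
  induction h with
  | refl s =>
    exact List.mem_saturate (c := InferStep P) (fun _ _ _ => InferStep.mono) (mem_suffixPairs.2 ⟨hs, ht⟩)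
      (inferStep_iff.2 (.inl rfl))
  | @step x s p q t h _ _ ih₁ ih₂ =>
    refine List.mem_saturate (c := InferStep P) (fun _ _ _ => InferStep.mono) (mem_suffixPairs.2 ⟨hs, ht⟩)
      (inferStep_iff.2 (.inr ⟨(p, q), h, x, s, t, rfl, rfl, ih₁ ?_ ?_, ih₂ ?_ ?_⟩))
    · obtain ⟨ρ, hρ, hs⟩ := hs
      exact ⟨ρ, hρ, (List.suffix_append x s).trans hs⟩
    · exact ⟨_, h, List.suffix_rfl⟩
    · exact ⟨_, h, List.suffix_rfl⟩
    · obtain ⟨ρ, hρ, ht⟩ := ht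
      exact ⟨ρ, hρ, (List.suffix_append x t).trans ht⟩

theorem derives_iff_mem_derivablePairs [DecidableEq α] {P : List (List α × List α)}
    {ρ : List α × List α}
    (hρ : ρ ∈ P) : Derives (ofList P) ρ.2 ρ.1 ↔ (ρ.2, ρ.1) ∈ derivablePairs P :=
  ⟨fun h => h.mem_derivablePairs ⟨ρ, hρ, List.suffix_rfl⟩ ⟨ρ, hρ, List.suffix_rfl⟩,
    fun h => derives_of_mem_derivablePairs _ h⟩

end Saturation

/-! ### Invariance under injective renaming of letters -/

section Map

variable {α β : Type*} {g : α → β}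

/-- The system whose rules are the images of the rules of `R` under a map of the letters. -/
def map (g : α → β) (R : SRS α) : SRS β :=
  Prod.map (List.map g) (List.map g) '' R

theorem mem_map_iff {R : SRS α} {ρ : List β × List β} :
    ρ ∈ R.map g ↔ ∃ l r, (l, r) ∈ R ∧ (l.map g, r.map g) = ρ := by
  simp [map]

theorem ofList_map (L : List (List α × List α)) :
    ofList (L.map (Prod.map (List.map g) (List.map g))) = (ofList L).map g := by
  ext ρ
  simp [ofList, map]

theorem Derives.map {P : SRS α} {s t : List α} (h : Derives P s t) (g : α → β) :
    Derives (P.map g) (s.map g) (t.map g) := by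
  induction h with
  | refl => exact .refl _
  | step x h _ _ ih₁ ih₂ =>
    rw [List.map_append, List.map_append]
    exact .step _ (mem_map_iff.2 ⟨_, _, h, rfl⟩) ih₁ ih₂

/-- All sides of rules are images, so a derivation starting from an image meets only images. -/
theorem Derives.exists_of_map (hg : g.Injective) {P : SRS α} {s : List α} {t' : List β}
    (h : Derives (P.map g) (s.map g) t') : ∃ t, t.map g = t' ∧ Derives P s t := by
  generalize e : s.map g = s' at h
  induction h generalizing s with
  | refl => exact ⟨s, e, .refl s⟩
  | @step x s₁ p' q' t₁ h _ _ ih₁ ih₂ =>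
    obtain ⟨x, s, rfl, rfl, rfl⟩ := List.map_eq_append_iff.1 e
    obtain ⟨p, q, hpq, e⟩ := mem_map_iff.1 h
    obtain ⟨rfl, rfl⟩ := Prod.mk.inj e
    obtain ⟨p₁, e₁, hs⟩ := ih₁ rfl
    obtain rfl := hg.list_map e₁
    obtain ⟨t, rfl, ht⟩ := ih₂ rfl
    exact ⟨x ++ t, by simp, .step x hpq hs ht⟩

theorem derives_map_iff (hg : g.Injective) {P : SRS α} {s t : List α} :
    Derives (P.map g) (s.map g) (t.map g) ↔ Derives P s t := by
  refine ⟨fun h => ?_, fun h => h.map g⟩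
  obtain ⟨t', e, h⟩ := h.exists_of_map hg
  exact hg.list_map e ▸ h

theorem rightReduced_iff {R : SRS α} :
    R.RightReduced ↔ ∀ ρ ∈ R, ∀ ρ' ∈ R, ¬ ρ'.1 <:+: ρ.2 := by
  constructor
  · rintro h ⟨l, r⟩ hρ ⟨l', r'⟩ hρ' ⟨x, y, e⟩
    exact h l r hρ (x ++ r' ++ y) ⟨x, y, l', r', hρ', e.symm, rfl⟩
  · rintro h l r hρ w ⟨x, y, l', r', hρ', e, -⟩
    exact h _ hρ _ hρ' ⟨x, y, e.symm⟩

theorem _root_.List.map_infix_map_iff (hg : g.Injective) {l r : List α} :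
    l.map g <:+: r.map g ↔ l <:+: r := by
  refine ⟨?_, fun h => h.map g⟩
  rintro ⟨x, y, e⟩
  obtain ⟨xl, y, rfl, e₁, rfl⟩ := List.map_eq_append_iff.1 e.symm
  obtain ⟨x, l', rfl, rfl, e₂⟩ := List.map_eq_append_iff.1 e₁
  exact ⟨x, y, by rw [hg.list_map e₂]⟩

theorem rightReduced_map_iff (hg : g.Injective) {R : SRS α} :
    (R.map g).RightReduced ↔ R.RightReduced := by
  simp only [rightReduced_iff, map, Set.forall_mem_image, Prod.map_fst, Prod.map_snd,
    List.map_infix_map_iff hg]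

/-- Injectivity keeps distinct rules distinct and lifts the equation `r₂ = x ++ r₁` from images to
the original strings. -/
theorem RHS_map (hg : g.Injective) (R : SRS α) :
    (R.map g).RHS = Sym2.map (List.map g) '' R.RHS := by
  have hinj : (Prod.map (List.map g) (List.map g)).Injective := hg.list_map.prodMap hg.list_map
  ext e
  constructor
  · rintro ⟨_, _, _, _, x, h₁, h₂, hne, hx, rfl⟩
    obtain ⟨⟨l₁, r₁⟩, h₁, e₁⟩ := h₁
    obtain ⟨⟨l₂, r₂⟩, h₂, e₂⟩ := h₂
    obtain ⟨rfl, rfl⟩ := Prod.mk.inj e₁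
    obtain ⟨rfl, rfl⟩ := Prod.mk.inj e₂
    obtain ⟨x, r, rfl, rfl, e⟩ := List.map_eq_append_iff.1 hx
    obtain rfl := hg.list_map e
    refine ⟨_, ⟨l₁, r, l₂, x ++ r, x, h₁, h₂, ?_, rfl, rfl⟩, by simp⟩
    intro h
    exact hne (congrArg (Prod.map (List.map g) (List.map g)) h)
  · rintro ⟨_, ⟨l₁, r₁, l₂, r₂, x, h₁, h₂, hne, rfl, rfl⟩, rfl⟩
    exact ⟨l₁.map g, r₁.map g, l₂.map g, (x ++ r₁).map g, x.map g, ⟨_, h₁, rfl⟩, ⟨_, h₂, rfl⟩,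
      fun h => hne (hinj h), by simp, by simp⟩

theorem endPair_map (e : Sym2 (List α)) :
    endPair (e.map (List.map g)) = (endPair e).map (Option.map g) := by
  induction e with
  | h x y => simp [endPair, List.getLast?_map]

theorem quasiDeterministic_map_iff (hg : g.Injective) {E : Set (Sym2 (List α))} :
    QuasiDeterministic (Sym2.map (List.map g) '' E) ↔ QuasiDeterministic E := by
  have hinj := Sym2.map.injective (Option.map_injective hg)
  have hinj' := Sym2.map.injective hg.list_map
  simp only [QuasiDeterministic, Set.forall_mem_image, endPair_map, hinj.ne_iff, hinj'.ne_iff,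
    Sym2.isDiag_map (Option.map_injective hg)]
  simp [Sym2.mem_map]

end Map

end SRS

/-! ### Primitive recursive list operations -/

section Primrec

variable {α β : Type*} [Primcodable α] [Primcodable β]

theorem PrimrecPred.exists_mem_of_primrec {f : α → List β} {p : α → β → Prop} (hf : Primrec f)
    (hp : PrimrecRel p) : PrimrecPred fun a => ∃ b ∈ f a, p a b :=
  (PrimrecRel.exists_mem_list hp.swap).comp hf .id

theorem PrimrecPred.forall_mem_of_primrec {f : α → List β} {p : α → β → Prop} (hf : Primrec f)
    (hp : PrimrecRel p) : PrimrecPred fun a => ∀ b ∈ f a, p a b :=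
  (PrimrecRel.forall_mem_list hp.swap).comp hf .id

theorem PrimrecRel.mem_list : PrimrecRel fun (a : α) (l : List α) => a ∈ l :=
  (PrimrecPred.exists_mem_of_primrec (p := fun (x : α × List α) b => b = x.1) .snd
    (Primrec.eq.comp .snd (Primrec.fst.comp .fst))).of_eq fun x => by simp

theorem Primrec.list_dropLast : Primrec (List.dropLast : List α → List α) :=
  (list_take.comp (nat_sub.comp list_length (const 1)) .id).of_eq fun l => by
    simp [List.dropLast_eq_take]

theorem Primrec.list_getLast? : Primrec (List.getLast? : List α → Option α) :=
  (list_head?.comp list_reverse).of_eq fun l => by simp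

theorem PrimrecRel.list_isSuffix : PrimrecRel fun l l' : List α => l <:+ l' :=
  PrimrecPred.of_eq (Primrec.eq.comp .fst (Primrec.list_drop.comp
    (Primrec.nat_sub.comp (Primrec.list_length.comp .snd) (Primrec.list_length.comp .fst)) .snd))
    fun x => by simp [List.suffix_iff_eq_drop]

theorem PrimrecRel.list_isInfix : PrimrecRel fun l l' : List α => l <:+: l' :=
  (PrimrecPred.exists_mem_of_primrec
    (f := fun x : List α × List α => List.range (x.2.length + 1))
    (p := fun x i => x.1 <:+ x.2.take i)
    (Primrec.list_range.comp (Primrec.succ.comp (Primrec.list_length.comp .snd)))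
    (PrimrecRel.list_isSuffix.comp (Primrec.fst.comp .fst)
      (Primrec.list_take.comp .snd (Primrec.snd.comp .fst)))).of_eq fun x => by
    dsimp only
    -- An infix is a suffix of a prefix, and the prefixes are indexed by their lengths.
    rw [List.infix_iff_suffix_prefix]
    constructor
    · rintro ⟨i, -, h⟩
      exact ⟨_, h, List.take_prefix _ _⟩
    · rintro ⟨t, h, y, e⟩
      refine ⟨t.length, ?_, ?_⟩
      · simp [← e]
      · simpa [← e] using h

theorem Primrec.list_saturate {γ : Type*} [Primcodable γ] {U : γ → List β}
    {c : γ → List β → β → Prop} [∀ x E a, Decidable (c x E a)] (hU : Primrec U)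
    (hc : PrimrecPred fun x : (γ × List β) × β => c x.1.1 x.1.2 x.2) :
    Primrec fun x => (U x).saturate (c x) := by
  refine nat_iterate (list_length.comp hU) (const []) ?_
  have h := (listFilterMap (f := fun x : γ × List β => U x.1)
    (g := fun x a => if c x.1 x.2 a then some a else none) (hU.comp fst)
    (ite hc (option_some.comp snd) (const none)))
  refine h.of_eq fun x => ?_
  simp only [List.saturateStep, ← List.filterMap_eq_filter]
  congr 1
  ext a
  simp [Option.guard]

end Primrec

/-! ### The collapse criterion on coded input -/

namespace SRS

/-- `SRS.appendRules` as a list, for a list of rules over the alphabet `{0, …, k - 1}`. -/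
def appendRuleList (k : ℕ) (L : List (List ℕ × List ℕ)) : List (List ℕ × List ℕ) :=
  L.map (fun ρ => (ρ.1.dropLast, ρ.2)) ++ (List.range k).map fun a => ([], [a])

theorem ofList_appendRuleList {k : ℕ} (L : List (List (Fin k) × List (Fin k))) :
    ofList (appendRuleList k (code k L).2) = (ofList L).appendRules.map Fin.val := by
  ext ⟨p, q⟩
  simp only [ofList, appendRuleList, code, appendRules, map, Set.mem_ofPred_eq, Set.mem_image,
    List.mem_append, List.mem_map, List.mem_range]
  constructor
  · rintro (⟨_, ⟨ρ, hρ, rfl⟩, e⟩ | ⟨a, ha, e⟩)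
    · exact ⟨_, .inl ⟨ρ, hρ, rfl⟩, by simp [← e, List.map_dropLast]⟩
    · exact ⟨_, .inr ⟨⟨a, ha⟩, rfl⟩, by simp [← e]⟩
  · rintro ⟨_, ⟨ρ, hρ, rfl⟩ | ⟨a, rfl⟩, e⟩
    · exact .inl ⟨_, ⟨ρ, hρ, rfl⟩, by simp [← e, List.map_dropLast]⟩
    · exact .inr ⟨a, a.isLt, by simp [← e]⟩

/-- The decidable criterion for a subterm-collapse. -/
def CollapseCriterion (c : ℕ × List (List ℕ × List ℕ)) : Prop :=
  ∃ ρ ∈ appendRuleList c.1 c.2, (ρ.2, ρ.1) ∈ derivablePairs (appendRuleList c.1 c.2)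

theorem collapseCriterion_code_iff {k : ℕ} {L : List (List (Fin k) × List (Fin k))}
    (hc : (ofList L).Convergent) (hf : (ofList L).ForwardClosed) :
    CollapseCriterion (code k L) ↔ (ofList L).SubtermCollapsing := by
  have h : CollapseCriterion (code k L) ↔
      ∃ ρ ∈ ofList (appendRuleList k (code k L).2),
        Derives (ofList (appendRuleList k (code k L).2)) ρ.2 ρ.1 :=
    exists_congr fun ρ => and_congr_right fun hρ => (derives_iff_mem_derivablePairs hρ).symm
  rw [h, subtermCollapsing_iff hc hf, ofList_appendRuleList]
  constructor
  · rintro ⟨_, ⟨ρ, hρ, rfl⟩, h⟩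
    exact ⟨ρ, hρ, (derives_map_iff Fin.val_injective).1 h⟩
  · rintro ⟨ρ, hρ, h⟩
    exact ⟨_, ⟨ρ, hρ, rfl⟩, h.map _⟩

section Primrec

open Primrec

theorem primrec_suffixes : Primrec (suffixes : List (List ℕ) → List (List ℕ)) :=
  list_flatMap .id (list_map (list_range.comp (succ.comp (list_length.comp snd)))
    (list_drop.comp snd (snd.comp fst)))

theorem primrec_suffixPairs :
    Primrec (suffixPairs : List (List ℕ × List ℕ) → List (List ℕ × List ℕ)) :=
  list_flatMap (primrec_suffixes.comp (list_map .id (snd.comp snd)))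
    (list_map (primrec_suffixes.comp (list_map fst (fst.comp snd)))
      (pair (snd.comp fst) snd))

theorem primrecPred_inferStep :
    PrimrecPred fun x : (List (List ℕ × List ℕ) × List (List ℕ × List ℕ)) × (List ℕ × List ℕ) =>
      InferStep x.1.1 x.1.2 x.2 := by
  refine .or (Primrec.eq.comp (fst.comp snd) (snd.comp snd)) ?_
  refine .exists_mem_of_primrec (fst.comp fst) ?_
  refine (PrimrecPred.exists_mem_of_primrec
    (f := fun y : ((List (List ℕ × List ℕ) × List (List ℕ × List ℕ)) × (List ℕ × List ℕ)) ×
      (List ℕ × List ℕ) => List.range (y.1.2.1.length + 1))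
    (p := fun y i => y.1.2.1.take i = y.1.2.2.take i ∧
      (y.1.2.1.drop i, y.2.1) ∈ y.1.1.2 ∧ (y.2.2, y.1.2.2.drop i) ∈ y.1.1.2)
    ?_ ?_).of_eq fun y => by simp
  · exact list_range.comp (succ.comp (list_length.comp (fst.comp (snd.comp fst))))
  · have hs := fst.comp (snd.comp (fst.comp (fst (α := ((List (List ℕ × List ℕ) ×
      List (List ℕ × List ℕ)) × (List ℕ × List ℕ)) × (List ℕ × List ℕ)) (β := ℕ))))
    have ht := snd.comp (snd.comp (fst.comp (fst (α := ((List (List ℕ × List ℕ) ×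
      List (List ℕ × List ℕ)) × (List ℕ × List ℕ)) × (List ℕ × List ℕ)) (β := ℕ))))
    have hE := snd.comp (fst.comp (fst.comp (fst (α := ((List (List ℕ × List ℕ) ×
      List (List ℕ × List ℕ)) × (List ℕ × List ℕ)) × (List ℕ × List ℕ)) (β := ℕ))))
    refine .and (Primrec.eq.comp (list_take.comp snd hs) (list_take.comp snd ht)) (.and ?_ ?_)
    · exact PrimrecRel.mem_list.comp (pair (list_drop.comp snd hs) (fst.comp (snd.comp fst))) hE
    · exact PrimrecRel.mem_list.comp (pair (snd.comp (snd.comp fst)) (list_drop.comp snd ht)) hE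

theorem primrec_derivablePairs :
    Primrec (derivablePairs : List (List ℕ × List ℕ) → List (List ℕ × List ℕ)) :=
  list_saturate primrec_suffixPairs primrecPred_inferStep

theorem primrec_appendRuleList : Primrec₂ appendRuleList :=
  list_append.comp
    (list_map snd (pair (list_dropLast.comp (fst.comp snd)) (snd.comp snd)))
    (list_map (list_range.comp fst) (pair (const []) (list_cons.comp snd (const []))))

theorem primrecPred_collapseCriterion : PrimrecPred CollapseCriterion := by
  have h : Primrec fun c : ℕ × List (List ℕ × List ℕ) => appendRuleList c.1 c.2 :=
    primrec_appendRuleList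
  exact .exists_mem_of_primrec h (PrimrecRel.mem_list.comp
    (pair (snd.comp snd) (fst.comp snd)) (primrec_derivablePairs.comp (h.comp fst)))

end Primrec

/-! ### Decidability of the conditions on right-hand sides -/

section RightHandSides

/-- The right-hand-side critical pairs of a list of rules, as a list of ordered pairs. -/
def rhsList {α : Type*} [DecidableEq α] (L : List (List α × List α)) : List (List α × List α) :=
  L.flatMap fun ρ₁ => L.flatMap fun ρ₂ =>
    if ρ₁ ≠ ρ₂ ∧ ρ₁.2 <:+ ρ₂.2 then
      -- The `take` recovers the unique `x` with `r₂ = x ++ r₁`.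
      [(ρ₂.2.take (ρ₂.2.length - ρ₁.2.length) ++ ρ₁.1, ρ₂.1)] else []

theorem RHS_ofList {α : Type*} [DecidableEq α] (L : List (List α × List α)) :
    (ofList L).RHS = {e | ∃ p ∈ rhsList L, s(p.1, p.2) = e} := by
  ext e
  simp only [RHS, rhsList, Set.mem_ofPred_eq, List.mem_flatMap, List.mem_ite_nil_right,
    List.mem_singleton]
  constructor
  · rintro ⟨l₁, r₁, l₂, _, x, h₁, h₂, hne, rfl, rfl⟩
    exact ⟨_, ⟨_, h₁, _, h₂, ⟨hne, List.suffix_append x r₁⟩, rfl⟩, by simp⟩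
  · rintro ⟨_, ⟨⟨l₁, r₁⟩, h₁, ⟨l₂, _⟩, h₂, ⟨hne, x, rfl⟩, rfl⟩, rfl⟩
    exact ⟨l₁, r₁, l₂, _, x, h₁, h₂, hne, rfl, by simp⟩

/-- The list holds ordered representatives of unordered pairs, so equality is tested in both orders,
for the pairs and for their last letters. -/
theorem quasiDeterministic_RHS_ofList_iff {α : Type*} [DecidableEq α]
    (L : List (List α × List α)) :
    QuasiDeterministic (ofList L).RHS ↔ ∀ p ∈ rhsList L, ¬ (p.1 = [] ∨ p.2 = []) ∧
      p.1.getLast? ≠ p.2.getLast? ∧ ∀ q ∈ rhsList L,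
        (p.1 = q.1 ∧ p.2 = q.2 ∨ p.1 = q.2 ∧ p.2 = q.1) ∨
        ¬ (p.1.getLast? = q.1.getLast? ∧ p.2.getLast? = q.2.getLast? ∨
          p.1.getLast? = q.2.getLast? ∧ p.2.getLast? = q.1.getLast?) := by
  simp only [QuasiDeterministic, RHS_ofList, Set.mem_ofPred_eq, forall_exists_index, and_imp,
    forall_apply_eq_imp_iff₂, endPair, Sym2.map_mk, Sym2.mem_iff, Sym2.mk_isDiag_iff, ne_eq,
    Sym2.eq_iff, ← forall_and, or_iff_not_imp_left, eq_comm (a := [])]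

theorem primrec_rhsList : Primrec (rhsList : List (List ℕ × List ℕ) → _) := by
  open Primrec in
  refine list_flatMap .id (list_flatMap fst (ite (.and ?_ ?_) (list_cons.comp ?_ (const []))
    (const [])))
  · exact .not (Primrec.eq.comp (snd.comp fst) snd)
  · exact PrimrecRel.list_isSuffix.comp (snd.comp (snd.comp fst)) (snd.comp snd)
  · exact pair (list_append.comp (list_take.comp (nat_sub.comp (list_length.comp (snd.comp snd))
      (list_length.comp (snd.comp (snd.comp fst)))) (snd.comp snd)) (fst.comp (snd.comp fst)))
      (fst.comp snd)

theorem primrecPred_quasiDeterministic :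
    PrimrecPred fun L : List (List ℕ × List ℕ) => QuasiDeterministic (ofList L).RHS := by
  open Primrec in
  refine PrimrecPred.of_eq ?_ fun L => (quasiDeterministic_RHS_ofList_iff L).symm
  have last : Primrec (List.getLast? : List ℕ → Option ℕ) := list_getLast?
  refine .forall_mem_of_primrec primrec_rhsList (.and (.not (.or ?_ ?_)) (.and ?_ ?_))
  · exact Primrec.eq.comp (fst.comp snd) (const [])
  · exact Primrec.eq.comp (snd.comp snd) (const [])
  · exact .not (Primrec.eq.comp (last.comp (fst.comp snd)) (last.comp (snd.comp snd)))
  · refine .forall_mem_of_primrec (primrec_rhsList.comp fst) ?_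
    have p₁ := fst.comp (snd.comp (fst (α := List (List ℕ × List ℕ) × (List ℕ × List ℕ))
      (β := List ℕ × List ℕ)))
    have p₂ := snd.comp (snd.comp (fst (α := List (List ℕ × List ℕ) × (List ℕ × List ℕ))
      (β := List ℕ × List ℕ)))
    have q₁ := fst.comp (snd (α := List (List ℕ × List ℕ) × (List ℕ × List ℕ))
      (β := List ℕ × List ℕ))
    have q₂ := snd.comp (snd (α := List (List ℕ × List ℕ) × (List ℕ × List ℕ))
      (β := List ℕ × List ℕ))
    exact .or (.or (.and (Primrec.eq.comp p₁ q₁) (Primrec.eq.comp p₂ q₂))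
      (.and (Primrec.eq.comp p₁ q₂) (Primrec.eq.comp p₂ q₁)))
      (.not (.or (.and (Primrec.eq.comp (last.comp p₁) (last.comp q₁))
        (Primrec.eq.comp (last.comp p₂) (last.comp q₂)))
      (.and (Primrec.eq.comp (last.comp p₁) (last.comp q₂))
        (Primrec.eq.comp (last.comp p₂) (last.comp q₁)))))

theorem primrecPred_rightReduced :
    PrimrecPred fun L : List (List ℕ × List ℕ) => (ofList L).RightReduced := by
  open Primrec in
  refine PrimrecPred.of_eq ?_ fun L => (rightReduced_iff (R := ofList L)).symm
  refine .forall_mem_of_primrec .id (.forall_mem_of_primrec fst (.not ?_))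
  exact PrimrecRel.list_isInfix.comp (fst.comp snd) (snd.comp (snd.comp fst))

end RightHandSides

/-! ### Assembly of the two algorithms -/

theorem EffectivelySolvable.of_primrecPred {P Q : ∀ k : ℕ, SRS (Fin k) → Prop}
    {C : ℕ × List (List ℕ × List ℕ) → Prop} (hC : PrimrecPred C)
    (h : ∀ (k : ℕ) (L : List (List (Fin k) × List (Fin k))), P k (ofList L) →
      (C (code k L) ↔ Q k (ofList L))) : EffectivelySolvable P Q := by
  classical
  exact ⟨fun c => decide (C c), hC.decide.to_comp, fun k L hP => by
    simpa using h k L hP⟩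

theorem ofList_code {k : ℕ} (L : List (List (Fin k) × List (Fin k))) :
    ofList (code k L).2 = (ofList L).map Fin.val :=
  ofList_map L

end SRS

theorem corollary2 :
    SRS.EffectivelySolvable
      (fun _ R => R.Convergent ∧ R.ForwardClosed ∧ R.RightReduced)
      (fun _ R => R.SubtermCollapsing) ∧
    SRS.EffectivelySolvable
      (fun _ R => R.Convergent ∧ R.ForwardClosed)
      (fun _ R => R.IsLMSystem) := by
  constructor
  · exact .of_primrecPred SRS.primrecPred_collapseCriterion fun k L h =>
      SRS.collapseCriterion_code_iff h.1 h.2.1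
  -- Convergence and forward closure are promised by the input, and they also make the collapse
  -- criterion correct; only the other three conditions are tested.
  · refine .of_primrecPred (.and (SRS.primrecPred_rightReduced.comp .snd)
      (.and (.not SRS.primrecPred_collapseCriterion)
        (SRS.primrecPred_quasiDeterministic.comp .snd))) fun k L h => ?_
    rw [SRS.ofList_code, SRS.rightReduced_map_iff Fin.val_injective,
      SRS.collapseCriterion_code_iff h.1 h.2, SRS.RHS_map Fin.val_injective,
      SRS.quasiDeterministic_map_iff Fin.val_injective]
    exact ⟨fun ⟨h₁, h₂, h₃⟩ => ⟨h.1, h₁, h₂, h.2, h₃⟩,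
      fun h => ⟨h.rightReduced, h.nonSubtermCollapsing, h.quasiDeterministic⟩⟩
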